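/- Let $\mathbb{T}$ be the unit circle with normalized Lebesgue measure, and let $H^2$ be the closed subspace of $L^2=L^2(\mathbb{T})$ consisting of the functions whose Fourier coefficients of negative index all vanish. For $\varphi\in L^\infty(\mathbb{T})$, let $T_\varphi:H^2\to H^2$ be the Toeplitz operator $T_\varphi f=\mathbb{P}_+(\varphi f)$, where $\mathbb{P}_+$ is the orthogonal projection of $L^2$ onto $H^2$. Suppose that $h\in H^2$, that $h\neq 0$ almost everywhere on $\mathbb{T}$ (so that $1/h$ is defined almost everywhere), and that $1/h\in H^2$. Then the Toeplitz operator $T_{\bar h/h}$ has trivial kernel and dense range. In particular, if $T_{\bar h/h}$ is Fredholm, then $T_{\bar h/h}$ is invertible (i.e. it is a bijection of $H^2$ with bounded inverse). -/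

import Mathlib

open MeasureTheory AddCircle ComplexConjugate
open scoped ENNReal

namespace HardyToeplitz

noncomputable section

/-- Normalized Lebesgue measure on the unit circle. The circle is parametrized by
`t ∈ ℝ / ℤ`, `ζ = exp (2 π i t)`, so that `fourier n t = ζ ^ n`. -/
abbrev circleMeasure : Measure UnitAddCircle := haarAddCircle

/-- `L²` of the unit circle. -/
abbrev CircleL2 : Type := Lp ℂ 2 circleMeasure

/-- A function on the circle (up to null sets) belongs to the Hardy space `H²`: it is square
integrable and its Fourier coefficients of negative index vanish. -/
def MemH2 (f : UnitAddCircle → ℂ) : Prop :=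
  MemLp f 2 circleMeasure ∧ ∀ n : ℤ, n < 0 → fourierCoeff f n = 0

/-- The Hardy space `H²`, as a subspace of `L²` of the circle. -/
def H2 : Submodule ℂ CircleL2 where
  carrier := {f | MemH2 f}
  zero_mem' := ⟨Lp.memLp _, fun n _ => by rw [← fourierBasis_repr]; simp⟩
  add_mem' := fun {f g} hf hg => ⟨Lp.memLp _, fun n hn => by
    rw [← fourierBasis_repr, map_add, lp.coeFn_add, Pi.add_apply, fourierBasis_repr,
      fourierBasis_repr, hf.2 n hn, hg.2 n hn, add_zero]⟩
  smul_mem' := fun c f hf => ⟨Lp.memLp _, fun n hn => by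
    rw [← fourierBasis_repr, map_smul, lp.coeFn_smul, Pi.smul_apply, fourierBasis_repr,
      hf.2 n hn, smul_zero]⟩

theorem isClosed_H2 : IsClosed (H2 : Set CircleL2) := by
  have h : (H2 : Set CircleL2) =
      ⋂ n : ℤ, ⋂ _ : n < 0, {f : CircleL2 | inner ℂ (fourierBasis n : CircleL2) f = 0} := by
    ext f
    simp only [Set.mem_iInter, Set.mem_ofPred_eq]
    constructor
    · intro hf n hn
      rw [← HilbertBasis.repr_apply_apply, fourierBasis_repr]
      exact hf.2 n hn
    · intro hf
      refine ⟨Lp.memLp f, fun n hn => ?_⟩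
      rw [← fourierBasis_repr, HilbertBasis.repr_apply_apply]
      exact hf n hn
  rw [h]
  exact isClosed_iInter fun n => isClosed_iInter fun _ =>
    isClosed_eq (continuous_const.inner continuous_id) continuous_const

instance instCompleteSpaceH2 : CompleteSpace H2 := isClosed_H2.completeSpace_coe

/-- Multiplication by a bounded function `φ`, as an operator on `L²`. -/
def mulOp (φ : Lp ℂ ∞ circleMeasure) : CircleL2 →L[ℂ] CircleL2 :=
  (ContinuousLinearMap.mul ℂ ℂ).holderL circleMeasure ∞ 2 2 φ

/-- The Toeplitz operator `T_φ : H² → H²`, `f ↦ P₊ (φ f)`, where `P₊` is the orthogonal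
projection of `L²` onto `H²`. -/
def toeplitz (φ : Lp ℂ ∞ circleMeasure) : H2 →L[ℂ] H2 :=
  H2.orthogonalProjectionOnto ∘L mulOp φ ∘L H2.subtypeL

/-- For `h ∈ H²`, the function `h̄ / h` is bounded. -/
theorem MemH2.memLp_conj_div {h : UnitAddCircle → ℂ} (hh : MemH2 h) :
    MemLp (fun t => conj (h t) / h t) ∞ circleMeasure := by
  have hm := hh.1.1.aemeasurable
  refine memLp_top_of_bound (C := 1) ?_ (.of_forall fun t => ?_)
  · exact ((Complex.continuous_conj.measurable.comp_aemeasurable hm).div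
      hm).aestronglyMeasurable
  · rw [norm_div, RCLike.norm_conj]
    exact div_self_le_one _

end

end HardyToeplitz

open Filter Topology

/-! If `f` is in the kernel, `w = (h̄/h) f` has only negative frequencies, and `u f = ū w` with `u =
1/h`. The left side has only nonnegative frequencies and the right side only negative ones, so both
vanish (`mul_ae_eq_zero_of_ae_eq_conj_mul`) and `f = 0`. If `g` is orthogonal to the range, the same
argument applies to `w = (h/h̄) g` with `u = h`. A Fredholm operator has closed range, so density
gives surjectivity. The products lie only in `L¹`, hence the need for uniqueness of Fourier
coefficients there. -/

theorem integral_mul_continuousMap_eq_zero_of_fourierCoeff_eq_zero {f : UnitAddCircle → ℂ}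
    (hf : Integrable f haarAddCircle) (h0 : ∀ n, fourierCoeff f n = 0) (g : C(UnitAddCircle, ℂ)) :
    ∫ t, g t * f t ∂haarAddCircle = 0 := by
  have hint : ∀ g : C(UnitAddCircle, ℂ), Integrable (fun t => g t * f t) haarAddCircle :=
    fun g => hf.bdd_mul g.continuous.aestronglyMeasurable (.of_forall g.norm_coe_le_norm)
  let L : C(UnitAddCircle, ℂ) →L[ℂ] ℂ := LinearMap.mkContinuous
    { toFun := fun g => ∫ t, g t * f t ∂haarAddCircle
      map_add' := fun a b => by
        simp only [ContinuousMap.add_apply, add_mul]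
        exact integral_add (hint a) (hint b)
      map_smul' := fun c a => by
        simp only [ContinuousMap.smul_apply, smul_eq_mul, mul_assoc, RingHom.id_apply]
        exact integral_const_mul _ _ }
    (∫ t, ‖f t‖ ∂haarAddCircle) fun g => by
      rw [mul_comm, ← integral_const_mul]
      refine norm_integral_le_of_norm_le (hf.norm.const_mul _) (.of_forall fun t => ?_)
      rw [norm_mul]
      gcongr
      exact g.norm_coe_le_norm t
  have hL : (⊤ : Submodule ℂ C(UnitAddCircle, ℂ)) ≤ L.ker := by
    rw [← span_fourier_closure_eq_top]
    refine Submodule.topologicalClosure_minimal _ (Submodule.span_le.2 ?_) L.isClosed_ker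
    rintro _ ⟨n, rfl⟩
    have := h0 (-n)
    rw [fourierCoeff, neg_neg] at this
    exact this
  exact hL (Submodule.mem_top (x := g))

/-- Indicators of closed sets are bounded pointwise limits of continuous functions, so dominated
convergence shows that `f` integrates to zero over every closed set. -/
theorem ae_eq_zero_of_fourierCoeff_eq_zero {f : UnitAddCircle → ℂ}
    (hf : Integrable f haarAddCircle) (h0 : ∀ n, fourierCoeff f n = 0) :
    f =ᵐ[haarAddCircle] 0 := by
  refine ae_eq_zero_of_forall_setIntegral_isClosed_eq_zero hf fun s hs => ?_
  have hδ : ∀ n : ℕ, (0 : ℝ) < 1 / (n + 1) := fun n => by positivity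
  have key := thickenedIndicator_tendsto_indicator_closure hδ
    tendsto_one_div_add_atTop_nhds_zero_nat s
  rw [hs.closure_eq, tendsto_pi_nhds] at key
  rw [← integral_indicator hs.measurableSet]
  refine tendsto_nhds_unique (f := fun n : ℕ =>
    ∫ t, ((thickenedIndicator (hδ n) s t : ℝ) : ℂ) * f t ∂haarAddCircle) (l := atTop) ?_ ?_
  · refine tendsto_integral_of_dominated_convergence (fun t => ‖f t‖) (fun n => ?_) hf.norm
      (fun n => .of_forall fun t => ?_) (.of_forall fun t => ?_)
    · refine AEStronglyMeasurable.mul ?_ hf.1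
      refine Continuous.aestronglyMeasurable ?_
      fun_prop
    · rw [norm_mul, Complex.norm_real, Real.norm_of_nonneg (NNReal.coe_nonneg _)]
      exact mul_le_of_le_one_left (norm_nonneg _)
        (by exact_mod_cast thickenedIndicator_le_one (hδ n) s t)
    · have h1 : Tendsto (fun n : ℕ => ((thickenedIndicator (hδ n) s t : ℝ) : ℂ) * f t) atTop
          (𝓝 (((s.indicator (fun _ => (1 : NNReal)) t : NNReal) : ℂ) * f t)) :=
        (((Complex.continuous_ofReal.comp NNReal.continuous_coe).tendsto _).comp
          (key t)).mul_const _
      convert h1 using 2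
      by_cases ht : t ∈ s <;> simp [ht]
  · have h2 : ∀ n : ℕ, ∫ t, ((thickenedIndicator (hδ n) s t : ℝ) : ℂ) * f t ∂haarAddCircle = 0 :=
      fun n => integral_mul_continuousMap_eq_zero_of_fourierCoeff_eq_zero hf h0
        ⟨fun t => ((thickenedIndicator (hδ n) s t : ℝ) : ℂ), by fun_prop⟩
    simp only [h2, tendsto_const_nhds]

theorem fourierCoeff_conj (f : UnitAddCircle → ℂ) (n : ℤ) :
    fourierCoeff (fun t => conj (f t)) n = conj (fourierCoeff f (-n)) := by
  rw [fourierCoeff, fourierCoeff, ← integral_conj]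
  refine integral_congr_ae (.of_forall fun t => ?_)
  simp only [smul_eq_mul, map_mul, fourier_neg, neg_neg]

theorem fourierCoeff_toLp_of_memLp {f : UnitAddCircle → ℂ} (hf : MemLp f 2 haarAddCircle) (n : ℤ) :
    fourierCoeff (hf.toLp f) n = fourierCoeff f n := by
  rw [fourierCoeff_congr_ae hf.coeFn_toLp]

theorem inner_fourierBasis_eq_fourierCoeff (f : Lp ℂ 2 (haarAddCircle (T := 1))) (n : ℤ) :
    inner ℂ (fourierBasis n : Lp ℂ 2 (haarAddCircle (T := 1))) f = fourierCoeff f n := by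
  rw [← HilbertBasis.repr_apply_apply, fourierBasis_repr]

/-- Parseval's identity for the inner product of `conj (fourier (-n) * f)` with `g`. -/
theorem hasSum_fourierCoeff_mul {f g : UnitAddCircle → ℂ} (hf : MemLp f 2 haarAddCircle)
    (hg : MemLp g 2 haarAddCircle) (n : ℤ) :
    HasSum (fun k => fourierCoeff f (n - k) * fourierCoeff g k)
      (fourierCoeff (fun t => f t * g t) n) := by
  have hF : MemLp (fun t => conj (fourier (-n) t * f t)) 2 haarAddCircle := by
    refine hf.of_le ?_ (.of_forall fun t => ?_)
    · exact Complex.continuous_conj.comp_aestronglyMeasurable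
        ((map_continuous (fourier (-n))).aestronglyMeasurable.mul hf.1)
    · rw [RCLike.norm_conj, norm_mul, fourier_apply, Circle.norm_coe, one_mul]
  convert! fourierBasis.hasSum_inner_mul_inner (hF.toLp _) (hg.toLp _) using 1
  · ext k
    rw [← inner_conj_symm, inner_fourierBasis_eq_fourierCoeff, inner_fourierBasis_eq_fourierCoeff,
      fourierCoeff_toLp_of_memLp, fourierCoeff_toLp_of_memLp, fourierCoeff_conj, Complex.conj_conj]
    congr 1
    refine integral_congr_ae (.of_forall fun t => ?_)
    simp only [smul_eq_mul, ← mul_assoc, ← fourier_add]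
    congr 3
    ring
  · rw [L2.inner_def]
    refine integral_congr_ae ?_
    filter_upwards [hF.coeFn_toLp, hg.coeFn_toLp] with t h1 h2
    rw [h1, h2, RCLike.inner_apply', Complex.conj_conj, smul_eq_mul, mul_assoc]

theorem fourierCoeff_mul_eq_zero {f g : UnitAddCircle → ℂ} (hf : MemLp f 2 haarAddCircle)
    (hg : MemLp g 2 haarAddCircle) {a b n : ℤ} (hfa : ∀ k < a, fourierCoeff f k = 0)
    (hgb : ∀ k < b, fourierCoeff g k = 0) (hn : n < a + b) :
    fourierCoeff (fun t => f t * g t) n = 0 := by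
  rw [← (hasSum_fourierCoeff_mul hf hg n).tsum_eq]
  convert tsum_zero with k
  rcases lt_or_ge k b with hk | hk
  · rw [hgb k hk, mul_zero]
  · rw [hfa _ (by omega), zero_mul]

namespace HardyToeplitz

/-- If `w` has only Fourier coefficients of negative index and `u f = ū w` with `u, f ∈ H²`,
then `u f` has no nonzero Fourier coefficients. -/
theorem mul_ae_eq_zero_of_ae_eq_conj_mul {u f w : UnitAddCircle → ℂ} (hu : MemH2 u) (hf : MemH2 f)
    (hw : MemLp w 2 circleMeasure) (hw0 : ∀ n : ℤ, 0 ≤ n → fourierCoeff w n = 0)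
    (h : (fun t => u t * f t) =ᵐ[circleMeasure] fun t => conj (u t) * w t) :
    (fun t => u t * f t) =ᵐ[circleMeasure] 0 := by
  refine ae_eq_zero_of_fourierCoeff_eq_zero (hu.1.integrable_mul hf.1) fun n => ?_
  rcases lt_or_ge n 0 with hn | hn
  · exact fourierCoeff_mul_eq_zero (a := 0) (b := 0) hu.1 hf.1 hu.2 hf.2 (by omega)
  · have hc : (fun t => conj (u t) * w t) = fun t => conj (u t * conj (w t)) := by
      ext t; simp
    have hw' : MemLp (fun t => conj (w t)) 2 circleMeasure := hw.star
    -- The frequencies of `conj w` start at 1, so those of `u * conj w` do too, while `-n ≤ 0`.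
    rw [fourierCoeff_congr_ae h, hc, fourierCoeff_conj,
      fourierCoeff_mul_eq_zero (a := 0) (b := 1) hu.1 hw' hu.2 (fun k hk => ?_) (by omega),
      map_zero]
    have := fourierCoeff_conj w k
    rw [hw0 _ (by omega), map_zero] at this
    exact this

theorem fourierBasis_mem_H2 {n : ℤ} (hn : 0 ≤ n) : (fourierBasis n : CircleL2) ∈ H2 := by
  refine ⟨Lp.memLp _, fun k hk => ?_⟩
  rw [← inner_fourierBasis_eq_fourierCoeff]
  exact fourierBasis.orthonormal.2 (by omega)

theorem coeFn_mulOp_toLp {φ : UnitAddCircle → ℂ} (hφ : MemLp φ ∞ circleMeasure) (f : CircleL2) :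
    mulOp hφ.toLp f =ᵐ[circleMeasure] fun t => φ t * f t := by
  filter_upwards [ContinuousLinearMap.coeFn_holder (r := 2) (ContinuousLinearMap.mul ℂ ℂ)
    hφ.toLp f, hφ.coeFn_toLp] with t h1 h2
  rw [← h2]
  exact h1

theorem inner_toeplitz (φ : Lp ℂ ∞ circleMeasure) (f g : H2) :
    inner ℂ (toeplitz φ f) g = inner ℂ (mulOp φ f) (g : CircleL2) :=
  Submodule.inner_orthogonalProjectionOnto_eq_of_mem_right g _

theorem ker_toeplitz_conj_div_eq_bot {h : UnitAddCircle → ℂ} (hh : MemH2 h)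
    (h_ne : ∀ᵐ t ∂circleMeasure, h t ≠ 0) (h_inv : MemH2 (fun t => 1 / h t)) :
    (toeplitz hh.memLp_conj_div.toLp).ker = ⊥ := by
  refine (Submodule.eq_bot_iff _).2 fun f hf => ?_
  have hf0 : toeplitz hh.memLp_conj_div.toLp f = 0 := hf
  have hφ := coeFn_mulOp_toLp hh.memLp_conj_div (f : CircleL2)
  have h0 := mul_ae_eq_zero_of_ae_eq_conj_mul h_inv f.2 (Lp.memLp _)
    (fun n hn => by
      rw [← inner_fourierBasis_eq_fourierCoeff]
      have h1 := inner_toeplitz hh.memLp_conj_div.toLp f ⟨_, fourierBasis_mem_H2 hn⟩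
      rw [hf0, inner_zero_left] at h1
      exact inner_eq_zero_symm.1 h1.symm) (by
      filter_upwards [hφ, h_ne] with t ht hne
      have : conj (h t) ≠ 0 := (map_ne_zero _).2 hne
      rw [ht]
      simp only [map_div₀, map_one]
      field_simp)
  refine Subtype.ext ((Lp.eq_zero_iff_ae_eq_zero).2 ?_)
  filter_upwards [h0, h_ne] with t ht hne
  exact (mul_eq_zero.1 ht).resolve_left (one_div_ne_zero hne)

theorem orthogonal_range_toeplitz_conj_div_eq_bot {h : UnitAddCircle → ℂ} (hh : MemH2 h)
    (h_ne : ∀ᵐ t ∂circleMeasure, h t ≠ 0) :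
    (toeplitz hh.memLp_conj_div.toLp).rangeᗮ = ⊥ := by
  refine (Submodule.eq_bot_iff _).2 fun g hg => ?_
  have hφ := hh.memLp_conj_div
  have hw : MemLp (fun t => conj (conj (h t) / h t) * (g : CircleL2) t) 2 circleMeasure :=
    (Lp.memLp (g : CircleL2)).mul hφ.star
  have h0 := mul_ae_eq_zero_of_ae_eq_conj_mul hh g.2 hw
    (fun n hn => by
      -- Pairing `g` with the image of the `n`-th basis vector gives the `n`-th coefficient of `φ̄
      -- g`.
      have h1 := (Submodule.mem_orthogonal _ _).1 hg _
        (LinearMap.mem_range_self _ (⟨_, fourierBasis_mem_H2 hn⟩ : H2))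
      rw [← h1]
      refine Eq.trans ?_ (inner_toeplitz hφ.toLp ⟨_, fourierBasis_mem_H2 hn⟩ g).symm
      rw [L2.inner_def]
      refine integral_congr_ae ?_
      have h2 : (fourierBasis n : CircleL2) =ᵐ[circleMeasure] fourier n := by
        rw [coe_fourierBasis]
        exact coeFn_fourierLp 2 n
      filter_upwards [coeFn_mulOp_toLp hφ (fourierBasis n : CircleL2), h2] with t h3 h4
      rw [h3, h4, RCLike.inner_apply', smul_eq_mul, fourier_neg, map_mul]
      ring) (by
      filter_upwards [h_ne] with t hne
      have : conj (h t) ≠ 0 := (map_ne_zero _).2 hne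
      simp only [map_div₀, Complex.conj_conj]
      field_simp)
  refine Subtype.ext ((Lp.eq_zero_iff_ae_eq_zero).2 ?_)
  filter_upwards [h0, h_ne] with t ht hne
  exact (mul_eq_zero.1 ht).resolve_left hne

end HardyToeplitz

theorem mainTheorem9 (h : UnitAddCircle → ℂ)
    (hh : HardyToeplitz.MemH2 h)
    (h_ne : ∀ᵐ t ∂HardyToeplitz.circleMeasure, h t ≠ 0)
    (h_inv : HardyToeplitz.MemH2 (fun t => 1 / h t)) :
    (HardyToeplitz.toeplitz hh.memLp_conj_div.toLp).ker = ⊥ ∧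
      DenseRange (HardyToeplitz.toeplitz hh.memLp_conj_div.toLp) ∧
      ((HardyToeplitz.toeplitz hh.memLp_conj_div.toLp).IsFredholm →
        (HardyToeplitz.toeplitz hh.memLp_conj_div.toLp).IsInvertible) := by
  have hker := HardyToeplitz.ker_toeplitz_conj_div_eq_bot hh h_ne h_inv
  have htop := (Submodule.topologicalClosure_eq_top_iff
    (K := (HardyToeplitz.toeplitz hh.memLp_conj_div.toLp).range)).2
    (HardyToeplitz.orthogonal_range_toeplitz_conj_div_eq_bot hh h_ne)
  refine ⟨hker, ?_, fun hF => ?_⟩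
  · have := (Submodule.dense_iff_topologicalClosure_eq_top).2 htop
    rwa [LinearMap.coe_range] at this
  · have hrange := hF.isClosed_range.submodule_topologicalClosure_eq.symm.trans htop
    -- The open mapping theorem makes the inverse bounded.
    exact ⟨.ofBijective _ hker hrange, rfl⟩
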